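/- Let an arc be (the image of) a simple plane curve $\gamma:[a,b]\to\mathbb{R}^2$, $a<b$, injective on $[a,b]$, parametrized by arc length, of class $C^1$ and piecewise $C^2$ (i.e. $C^2$ up to the endpoints on each closed piece of some finite subdivision of $[a,b]$), with endpoints $p=\gamma(a)$ and $q=\gamma(b)$. Its elastic energy is $E(\gamma)=\frac12\int_a^b k(s)^2\,ds$, where $k$ is the signed curvature. The arc is said to hold an open convex set $K\subset\mathbb{R}^2$ if $\partial K$ is the union of the arc and of the straight segment $\overline{pq}$, and the tangents to the arc at $p$ and at $q$ are parallel. If two such arcs $\gamma$ and $\gamma'$, not necessarily belonging to the same closed curve, hold two disjoint open convex sets $\Omega$ and $\Omega'$ respectively, then $$A(\Omega\cup\Omega')\,\bigl(E(\gamma)+E(\gamma')\bigr)^2\ \ge\ \pi^3,$$ where $A$ denotes area. -/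

import Mathlib

open MeasureTheory Set

/-- The Euclidean plane. -/
abbrev Plane : Type := EuclideanSpace ℝ (Fin 2)

namespace PlaneArc

/-- The tangent vector `𝐭(s) = γ'(s)` of the arc `γ : [a, b] → ℝ²` (one-sided at the endpoints). -/
noncomputable def tangent (γ : ℝ → Plane) (a b s : ℝ) : Plane :=
  derivWithin γ (Icc a b) s

/-- The normal vector: the tangent vector rotated by `π / 2` counterclockwise. -/
noncomputable def normal (γ : ℝ → Plane) (a b s : ℝ) : Plane :=
  !₂[-(tangent γ a b s 1), tangent γ a b s 0]

/-- The signed curvature `k` of an arc parametrized by arc length, `𝐭' = k 𝐧`, that is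
`k = ⟨𝐭', 𝐧⟩`. -/
noncomputable def curvature (γ : ℝ → Plane) (a b s : ℝ) : ℝ :=
  inner ℝ (derivWithin (tangent γ a b) (Icc a b) s) (normal γ a b s)

/-- The elastic energy `E = ½ ∫ k(s)² ds` of an arc parametrized by arc length on `[a, b]`. -/
noncomputable def elasticEnergy (γ : ℝ → Plane) (a b : ℝ) : ℝ :=
  (1 / 2) * ∫ s in a..b, curvature γ a b s ^ 2

/-- `γ` is piecewise `C²` on `[a, b]`: there is a finite subdivision `a = s₀ < ⋯ < sₙ = b` such that
`γ` is `C²` up to the endpoints on each closed piece `[sᵢ, sᵢ₊₁]`. -/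
def PiecewiseC2On (γ : ℝ → Plane) (a b : ℝ) : Prop :=
  ∃ (n : ℕ) (s : ℕ → ℝ), s 0 = a ∧ s n = b ∧
    ∀ i < n, s i < s (i + 1) ∧ ContDiffOn ℝ 2 γ (Icc (s i) (s (i + 1)))

/-- `γ` restricted to `[a, b]` is a simple plane arc with distinct endpoints, parametrized by arc
length, of class `C¹` and piecewise `C²`. -/
structure IsSmoothArc (γ : ℝ → Plane) (a b : ℝ) : Prop where
  lt : a < b
  contDiffOn : ContDiffOn ℝ 1 γ (Icc a b)
  piecewise : PiecewiseC2On γ a b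
  unit_speed : ∀ s ∈ Icc a b, ‖tangent γ a b s‖ = 1
  simple : InjOn γ (Icc a b)

/-- The arc `γ([a, b])` from `p = γ a` to `q = γ b` holds the open convex set `K`: the boundary of
`K` consists of the arc and of the segment `pq`, and the tangents to `γ` at `p` and `q` are
parallel. -/
structure HoldsConvexSet (γ : ℝ → Plane) (a b : ℝ) (K : Set Plane) : Prop where
  isOpen : IsOpen K
  convex : Convex ℝ K
  frontier_eq : frontier K = segment ℝ (γ a) (γ b) ∪ γ '' Icc a b
  parallel : ∃ r : ℝ, tangent γ a b b = r • tangent γ a b a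

end PlaneArc

/-! By symmetry in the two arcs it suffices to have the one-arc bound A E² ≥ π³/8
(`HoldsConvexSet.area_mul_sq_energy_ge`). Adding A ≥ π³/(8E²) and its analogue for the second arc,
the inequality of means turns the factor 1/8 into 1 (`eight_mul_le_add_mul_sq`).

For one arc, every tangent line supports the convex set, always on the same side, so after a
possible reflection the curvature κ is nonnegative. The end tangents are parallel and the arc is not
straight, so the tangent turns by at least π. Cutting the arc where it has turned by exactly π
leaves the convex set unchanged and does not increase ∫κ².

Let l be the length of the shortened arc, m the midpoint of its chord, p(s) the distance from m to
the tangent line at s, P = ∫p and Q = ∫κ². The end tangents are now opposite, so the arc and its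
reflection in m form a closed curve symmetric about m, and the argument is Gage's inequality for it:
(a) the cone over the arc from m gives A ≥ P/2 (`half_integral_le_volume`); (b) Bonnesen's
inequality P/2 + (π/2) p(t)² ≤ l p(t) holds for every t, by Schmidt's comparison with a circle of
radius p(t); integrating over t gives π ∫p² ≤ l P (`FramedCurve.bonnesen`); (c) Minkowski's formula
∫pκ = l and Cauchy–Schwarz give l² ≤ Q ∫p², hence πl ≤ PQ by (b); (d) Cauchy–Schwarz for ∫κ = π
gives π² ≤ lQ. Therefore π³ ≤ πlQ ≤ PQ², and A E² ≥ (P/2)(Q/2)² ≥ π³/8. -/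

/-- An odd primitive of `√(r² - x²)`, whose value at `r` is a quarter of the area of a disc. -/
theorem exists_odd_primitive_sqrt (r : ℝ) (hr : 0 ≤ r) :
    ∃ F : ℝ → ℝ, (∀ x, HasDerivAt F √(r ^ 2 - x ^ 2) x) ∧ (∀ x, F (-x) = -F x) ∧
      F r = Real.pi * r ^ 2 / 4 := by
  have hc : Continuous fun x : ℝ => √(r ^ 2 - x ^ 2) := by fun_prop
  have hodd : ∀ x : ℝ, ∫ u in (0 : ℝ)..(-x), √(r ^ 2 - u ^ 2)
      = -∫ u in (0 : ℝ)..x, √(r ^ 2 - u ^ 2) := by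
    intro x
    have h := intervalIntegral.integral_comp_neg (a := 0) (b := x)
      (fun u : ℝ => √(r ^ 2 - u ^ 2))
    simp only [neg_sq, neg_zero] at h
    rw [h, ← intervalIntegral.integral_symm]
  refine ⟨fun x => ∫ u in (0 : ℝ)..x, √(r ^ 2 - u ^ 2), fun x => ?_, hodd, ?_⟩
  · exact intervalIntegral.integral_hasDerivAt_right (hc.intervalIntegrable _ _)
      (hc.stronglyMeasurableAtFilter _ _) hc.continuousAt
  · have h1 : ∫ u in (-r)..r, √(r ^ 2 - u ^ 2) = 2 * ∫ u in (0 : ℝ)..r, √(r ^ 2 - u ^ 2) := by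
      rw [← intervalIntegral.integral_add_adjacent_intervals (b := 0)
        (hc.intervalIntegrable _ _) (hc.intervalIntegrable _ _),
        intervalIntegral.integral_symm, hodd]
      ring
    have h2 : ∫ u in (-r)..r, √(r ^ 2 - u ^ 2) = r ^ 2 * (Real.pi / 2) := by
      have h := intervalIntegral.mul_integral_comp_mul_left (a := -1) (b := 1)
        (f := fun u : ℝ => √(r ^ 2 - u ^ 2)) (c := r)
      simp only [mul_neg, mul_one] at h
      have e : ∀ u : ℝ, √(r ^ 2 - (r * u) ^ 2) = r * √(1 - u ^ 2) := fun u => by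
        rw [show r ^ 2 - (r * u) ^ 2 = r ^ 2 * (1 - u ^ 2) by ring,
          Real.sqrt_mul (sq_nonneg r), Real.sqrt_sq hr]
      simp only [e, intervalIntegral.integral_const_mul, integral_sqrt_one_sub_sq] at h
      rw [← h]
      ring
    simp only
    linarith

/-- The Cauchy–Schwarz inequality for interval integrals. -/
theorem sq_integral_mul_le {f g : ℝ → ℝ} {a b : ℝ} (hab : a ≤ b)
    (hf : IntervalIntegrable (fun s => f s ^ 2) volume a b)
    (hg : IntervalIntegrable (fun s => g s ^ 2) volume a b)
    (hfg : IntervalIntegrable (fun s => f s * g s) volume a b) :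
    (∫ s in a..b, f s * g s) ^ 2 ≤ (∫ s in a..b, f s ^ 2) * ∫ s in a..b, g s ^ 2 := by
  have key : ∀ t : ℝ, 0 ≤ (∫ s in a..b, f s ^ 2) * (t * t)
      + (2 * ∫ s in a..b, f s * g s) * t + ∫ s in a..b, g s ^ 2 := by
    intro t
    have h : ∫ s in a..b, (t * f s + g s) ^ 2 = (∫ s in a..b, f s ^ 2) * (t * t)
        + (2 * ∫ s in a..b, f s * g s) * t + ∫ s in a..b, g s ^ 2 := by
      have e : (fun s => (t * f s + g s) ^ 2)
          = fun s => (t * t) * f s ^ 2 + (2 * t) * (f s * g s) + g s ^ 2 := by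
        funext s; ring
      rw [e, intervalIntegral.integral_add ((hf.const_mul _).add (hfg.const_mul _)) hg,
        intervalIntegral.integral_add (hf.const_mul _) (hfg.const_mul _),
        intervalIntegral.integral_const_mul, intervalIntegral.integral_const_mul]
      ring
    rw [← h]
    exact intervalIntegral.integral_nonneg hab fun s _ => sq_nonneg _
  have := discrim_le_zero key
  rw [discrim] at this
  nlinarith

/-! ### Area of a cone over a curve -/

/-- A cone with apex `m` over a curve, seen from `m` through supporting lines, has area at least
`½ ∫ p`, where `p` is the distance from `m` to the tangent line. -/
theorem half_integral_le_volume {X Y U V : ℝ → ℝ} {a b m₁ m₂ : ℝ} {K : Set (ℝ × ℝ)} (hab : a ≤ b)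
    (hX : ContinuousOn X (Icc a b)) (hY : ContinuousOn Y (Icc a b))
    (hU : ContinuousOn U (Icc a b)) (hV : ContinuousOn V (Icc a b))
    (hdX : ∀ s ∈ Ioo a b, HasDerivAt X (U s) s) (hdY : ∀ s ∈ Ioo a b, HasDerivAt Y (V s) s)
    (hinj : InjOn (fun s => (X s, Y s)) (Icc a b))
    (hK : Convex ℝ K) (hm : (m₁, m₂) ∈ K) (hXY : ∀ s ∈ Icc a b, (X s, Y s) ∈ K)
    (hsupp : ∀ s ∈ Icc a b, ∀ p ∈ K, 0 ≤ (p.2 - Y s) * U s - (p.1 - X s) * V s)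
    (hfin : volume K ≠ ⊤) :
    1 / 2 * ∫ s in a..b, ((X s - m₁) * V s - (Y s - m₂) * U s) ≤ (volume K).toReal := by
  set p : ℝ → ℝ := fun s => (X s - m₁) * V s - (Y s - m₂) * U s with hp
  have hpc : ContinuousOn p (Icc a b) := by fun_prop
  have hp0 : ∀ s ∈ Icc a b, 0 ≤ p s := by
    intro s hs
    have := hsupp s hs _ hm
    simp only [hp]; simp only at this; linarith
  -- Where p vanishes, the tangent line passes through m and the cone map may fail to be injective;
  -- such parameters contribute nothing to ∫p.
  set S : Set ℝ := {s ∈ Ioo a b | p s ≠ 0} with hS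
  have hSo : IsOpen S :=
    (hpc.mono Ioo_subset_Icc_self).isOpen_inter_preimage isOpen_Ioo isOpen_ne
  set D : Set (ℝ × ℝ) := Ioo 0 1 ×ˢ S with hD
  have hDo : IsOpen D := isOpen_Ioo.prod hSo
  -- Polar-type coordinates around m. The Jacobian is r p(s), and ∫₀¹ r dr supplies the factor 1/2.
  set G : ℝ × ℝ → ℝ × ℝ := fun q => (m₁ + q.1 * (X q.2 - m₁), m₂ + q.1 * (Y q.2 - m₂)) with hG
  set G' : ℝ × ℝ → ℝ × ℝ →L[ℝ] ℝ × ℝ := fun q => (Matrix.toLin (Module.Basis.finTwoProd ℝ)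
    (Module.Basis.finTwoProd ℝ)
      !![X q.2 - m₁, q.1 * U q.2; Y q.2 - m₂, q.1 * V q.2]).toContinuousLinearMap with hG'
  have hdet : ∀ q, (G' q).det = q.1 * p q.2 := by
    intro q
    simp only [hG', hp]
    rw [ContinuousLinearMap.det, LinearMap.coe_toContinuousLinearMap, LinearMap.det_toLin,
      Matrix.det_fin_two_of]
    ring
  have hderiv : ∀ q ∈ D, HasFDerivWithinAt G (G' q) D q := by
    rintro ⟨r, s⟩ ⟨hr, hs⟩
    refine HasFDerivAt.hasFDerivWithinAt ?_
    have h1 : HasFDerivAt (fun q : ℝ × ℝ => X q.2) _ (r, s) :=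
      HasDerivAt.comp_hasFDerivAt (r, s) (hdX s hs.1) (hasFDerivAt_snd (𝕜 := ℝ))
    have h2 : HasFDerivAt (fun q : ℝ × ℝ => Y q.2) _ (r, s) :=
      HasDerivAt.comp_hasFDerivAt (r, s) (hdY s hs.1) (hasFDerivAt_snd (𝕜 := ℝ))
    have h0 : HasFDerivAt (fun q : ℝ × ℝ => q.1) _ (r, s) := hasFDerivAt_fst (𝕜 := ℝ)
    simp only [hG', Matrix.toLin_finTwoProd_toContinuousLinearMap]
    refine (((h0.fun_mul (h1.sub_const m₁)).const_add m₁).prodMk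
      ((h0.fun_mul (h2.sub_const m₂)).const_add m₂)).congr_fderiv ?_
    ext <;> simp
  have hGinj : InjOn G D := by
    -- If two points of the curve lie on one ray from m, the one at s is at least as far out as the
    -- one at s'; since p(s') > 0, the supporting line at s' forbids it to be strictly farther.
    have aux : ∀ r s r' s' : ℝ, 0 < r → r ≤ r' → s ∈ S → s' ∈ S →
        G (r, s) = G (r', s') → s = s' := by
      intro r s r' s' hr hrr hs hs' h
      have hs1 := Ioo_subset_Icc_self hs.1
      have hs1' := Ioo_subset_Icc_self hs'.1
      simp only [hG, Prod.mk.injEq] at h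
      have h1 : r * (X s - m₁) = r' * (X s' - m₁) := by linarith [h.1]
      have h2 : r * (Y s - m₂) = r' * (Y s' - m₂) := by linarith [h.2]
      have hsup := hsupp s' hs1' _ (hXY s hs1)
      simp only at hsup
      have hps : 0 < p s' := lt_of_le_of_ne (hp0 s' hs1') (Ne.symm hs'.2)
      have h3 : r * ((Y s - Y s') * U s' - (X s - X s') * V s') = -((r' - r) * p s') := by
        simp only [hp]
        linear_combination U s' * h2 - V s' * h1
      have h4 : r' = r := by
        have : 0 ≤ -((r' - r) * p s') := h3 ▸ mul_nonneg hr.le hsup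
        nlinarith
      subst h4
      apply hinj hs1 hs1'
      have e1 := mul_left_cancel₀ hr.ne' h1
      have e2 := mul_left_cancel₀ hr.ne' h2
      simp only [Prod.mk.injEq]
      exact ⟨by linarith, by linarith⟩
    rintro ⟨r, s⟩ ⟨hr, hs⟩ ⟨r', s'⟩ ⟨hr', hs'⟩ h
    simp only at hr hs hr' hs'
    have hss : s = s' := by
      rcases le_total r r' with hle | hle
      · exact aux r s r' s' hr.1 hle hs hs' h
      · exact (aux r' s' r s hr'.1 hle hs' hs h.symm).symm
    subst hss
    simp only [hG, Prod.mk.injEq] at h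
    have h3 : (r - r') * p s = 0 := by
      simp only [hp]
      linear_combination V s * h.1 - U s * h.2
    rcases mul_eq_zero.1 h3 with h4 | h4
    · rw [sub_eq_zero.1 h4]
    · exact absurd h4 hs.2
  have himg : G '' D ⊆ K := by
    rintro _ ⟨⟨r, s⟩, ⟨hr, hs⟩, rfl⟩
    have := hK hm (hXY s (Ioo_subset_Icc_self hs.1)) (sub_nonneg.2 hr.2.le) hr.1.le (by ring)
    convert this using 1
    simp only [hG, Prod.smul_mk, smul_eq_mul, Prod.mk_add_mk, Prod.mk.injEq]
    constructor <;> ring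
  have harea := lintegral_abs_det_fderiv_eq_addHaar_image volume hDo.measurableSet hderiv hGinj
  have hle : ∫⁻ q in D, ENNReal.ofReal |(G' q).det| ≤ volume K := harea ▸ measure_mono himg
  have hpi : IntegrableOn p S :=
    (hpc.integrableOn_Icc).mono_set fun s hs => Ioo_subset_Icc_self hs.1
  have hri : IntegrableOn (fun r : ℝ => r) (Ioo 0 1) :=
    (continuous_id.continuousOn.integrableOn_Icc).mono_set Ioo_subset_Icc_self
  have hprod : ∫ q in D, q.1 * p q.2 = (∫ r in Ioo (0 : ℝ) 1, r) * ∫ s in S, p s :=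
    setIntegral_prod_mul (fun r : ℝ => r) p (Ioo 0 1) S
  have hint : ∫ q in D, q.1 * p q.2 ≤ (volume K).toReal := by
    rw [integral_eq_lintegral_of_nonneg_ae]
    · refine ENNReal.toReal_mono hfin (le_trans ?_ hle)
      refine lintegral_mono fun q => ENNReal.ofReal_le_ofReal ?_
      rw [hdet]
      exact le_abs_self _
    · refine (ae_restrict_mem hDo.measurableSet).mono fun q hq => ?_
      exact mul_nonneg hq.1.1.le (hp0 _ (Ioo_subset_Icc_self hq.2.1))
    · refine ContinuousOn.aestronglyMeasurable ?_ hDo.measurableSet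
      refine continuousOn_fst.mul ?_
      exact hpc.comp continuousOn_snd fun q hq => Ioo_subset_Icc_self hq.2.1
  have hr : ∫ r in Ioo (0 : ℝ) 1, r = 1 / 2 := by
    rw [← integral_Ioc_eq_integral_Ioo, ← intervalIntegral.integral_of_le zero_le_one]
    simp
  have hSint : ∫ s in S, p s = ∫ s in a..b, p s := by
    rw [intervalIntegral.integral_of_le hab, integral_Ioc_eq_integral_Ioo]
    refine (setIntegral_eq_of_subset_of_forall_sdiff_eq_zero measurableSet_Ioo
      (fun s hs => hs.1) fun s hs => ?_).symm
    by_contra h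
    exact hs.2 ⟨hs.1, h⟩
  rw [hprod, hr, hSint] at hint
  exact hint

/-! ### Turning angle, convexity and Minkowski's formula -/

/-- A plane curve `(X, Y)` on `[a, b]` with unit tangent `(U, V)` and signed curvature `κ`, where
the curvature may fail to exist on a countable set `C`. -/
structure FramedCurve (X Y U V κ : ℝ → ℝ) (C : Set ℝ) (a b : ℝ) : Prop where
  lt : a < b
  countable : C.Countable
  contX : ContinuousOn X (Icc a b)
  contY : ContinuousOn Y (Icc a b)
  contU : ContinuousOn U (Icc a b)
  contV : ContinuousOn V (Icc a b)
  derivX : ∀ s ∈ Ioo a b, HasDerivAt X (U s) s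
  derivY : ∀ s ∈ Ioo a b, HasDerivAt Y (V s) s
  derivU : ∀ s ∈ Ioo a b \ C, HasDerivAt U (-(κ s * V s)) s
  derivV : ∀ s ∈ Ioo a b \ C, HasDerivAt V (κ s * U s) s
  contCurv : ∀ s ∈ Ioo a b \ C, ContinuousAt κ s
  unit : ∀ s ∈ Icc a b, U s ^ 2 + V s ^ 2 = 1
  intCurv : IntervalIntegrable κ volume a b
  intCurvSq : IntervalIntegrable (fun s => κ s ^ 2) volume a b

namespace FramedCurve

variable {X Y U V κ : ℝ → ℝ} {C : Set ℝ} {a b : ℝ}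

theorem mono_right (h : FramedCurve X Y U V κ C a b) {d : ℝ} (had : a < d) (hdb : d ≤ b) :
    FramedCurve X Y U V κ C a d := by
  have h1 : Icc a d ⊆ Icc a b := Icc_subset_Icc_right hdb
  have h2 : Ioo a d ⊆ Ioo a b := Ioo_subset_Ioo_right hdb
  have h3 : Ioo a d \ C ⊆ Ioo a b \ C := sdiff_subset_sdiff_left h2
  have h4 : uIcc a d ⊆ uIcc a b := by rwa [uIcc_of_le had.le, uIcc_of_le h.lt.le]
  exact
    { lt := had
      countable := h.countable
      contX := h.contX.mono h1
      contY := h.contY.mono h1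
      contU := h.contU.mono h1
      contV := h.contV.mono h1
      derivX := fun s hs => h.derivX s (h2 hs)
      derivY := fun s hs => h.derivY s (h2 hs)
      derivU := fun s hs => h.derivU s (h3 hs)
      derivV := fun s hs => h.derivV s (h3 hs)
      contCurv := fun s hs => h.contCurv s (h3 hs)
      unit := fun s hs => h.unit s (h1 hs)
      intCurv := h.intCurv.mono_set h4
      intCurvSq := h.intCurvSq.mono_set h4 }

theorem intCurv_right (h : FramedCurve X Y U V κ C a b) {s : ℝ} (hs : s ∈ Icc a b) :
    IntervalIntegrable κ volume a s :=
  h.intCurv.mono_set (by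
    rw [uIcc_of_le hs.1, uIcc_of_le h.lt.le]; exact Icc_subset_Icc_right hs.2)

theorem continuousOn_angle (h : FramedCurve X Y U V κ C a b) :
    ContinuousOn (fun s => ∫ u in a..s, κ u) (Icc a b) := by
  have := intervalIntegral.continuousOn_primitive_interval (f := κ) (a := a) (b := b)
    (μ := volume) ?_
  · rwa [uIcc_of_le h.lt.le] at this
  · rw [uIcc_of_le h.lt.le]
    exact (intervalIntegrable_iff_integrableOn_Icc_of_le h.lt.le).1 h.intCurv

theorem hasDerivAt_angle (h : FramedCurve X Y U V κ C a b) {s : ℝ} (hs : s ∈ Ioo a b \ C) :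
    HasDerivAt (fun s => ∫ u in a..s, κ u) (κ s) s := by
  refine intervalIntegral.integral_hasDerivAt_right
    (h.intCurv_right (Ioo_subset_Icc_self hs.1)) ?_ (h.contCurv s hs)
  have := ((intervalIntegrable_iff_integrableOn_Icc_of_le h.lt.le).1 h.intCurv).aestronglyMeasurable
  exact ⟨Icc a b, Icc_mem_nhds hs.1.1 hs.1.2, this⟩

/-- The tangent is the initial tangent rotated by the integral of the curvature. -/
theorem tangent_eq (h : FramedCurve X Y U V κ C a b) {s : ℝ} (hs : s ∈ Icc a b) :
    U s = Real.cos (∫ u in a..s, κ u) * U a - Real.sin (∫ u in a..s, κ u) * V a ∧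
      V s = Real.sin (∫ u in a..s, κ u) * U a + Real.cos (∫ u in a..s, κ u) * V a := by
  set φ : ℝ → ℝ := fun s => ∫ u in a..s, κ u with hφ
  have hφa : φ a = 0 := intervalIntegral.integral_same
  have hsub : Icc a s ⊆ Icc a b := Icc_subset_Icc_right hs.2
  have hφc : ContinuousOn φ (Icc a s) := h.continuousOn_angle.mono hsub
  have hU := h.contU.mono hsub
  have hV := h.contV.mono hsub
  have hmem : ∀ u ∈ Ioo a s \ C, u ∈ Ioo a b \ C := fun u hu => ⟨⟨hu.1.1, hu.1.2.trans_le hs.2⟩, hu.2⟩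
  -- The tangent rotated back by the angle φ has zero derivative off `C`; `h1` and `h2` are its two
  -- components.
  have h1 := integral_eq_of_hasDerivAt_off_countable_of_le
    (fun u => Real.cos (φ u) * U u + Real.sin (φ u) * V u) (fun _ => 0) hs.1 h.countable
    (by fun_prop) (fun u hu => ?_) intervalIntegrable_const
  have h2 := integral_eq_of_hasDerivAt_off_countable_of_le
    (fun u => Real.cos (φ u) * V u - Real.sin (φ u) * U u) (fun _ => 0) hs.1 h.countable
    (by fun_prop) (fun u hu => ?_) intervalIntegrable_const
  · simp only [intervalIntegral.integral_zero, hφa, Real.cos_zero, Real.sin_zero] at h1 h2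
    have h3 := Real.sin_sq_add_cos_sq (φ s)
    simp only [hφ] at h1 h2 h3 ⊢
    constructor
    · linear_combination (-U s) * h3 - Real.cos (φ s) * h1 + Real.sin (φ s) * h2
    · linear_combination (-V s) * h3 - Real.sin (φ s) * h1 - Real.cos (φ s) * h2
  · have hd := h.hasDerivAt_angle (hmem u hu)
    refine ((hd.cos.fun_mul (h.derivV u (hmem u hu))).fun_sub
      (hd.sin.fun_mul (h.derivU u (hmem u hu)))).congr_deriv ?_
    ring
  · have hd := h.hasDerivAt_angle (hmem u hu)
    refine ((hd.cos.fun_mul (h.derivU u (hmem u hu))).fun_add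
      (hd.sin.fun_mul (h.derivV u (hmem u hu)))).congr_deriv ?_
    ring

/-- A curve lying to the left of all its tangent lines has nonnegative curvature. -/
theorem curvature_nonneg (h : FramedCurve X Y U V κ C a b)
    (hsupp : ∀ s ∈ Icc a b, ∀ t ∈ Icc a b, 0 ≤ (Y t - Y s) * U s - (X t - X s) * V s)
    {s : ℝ} (hs : s ∈ Ioo a b \ C) : 0 ≤ κ s := by
  by_contra! hneg
  set g : ℝ → ℝ := fun t => (Y t - Y s) * U s - (X t - X s) * V s with hg
  have hnhds : Ioo a b ∈ nhds s := isOpen_Ioo.mem_nhds hs.1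
  have hd : ∀ t ∈ Ioo a b, HasDerivAt g (V t * U s - U t * V s) t := fun t ht =>
    (((h.derivY t ht).sub_const (Y s)).mul_const (U s)).fun_sub
      (((h.derivX t ht).sub_const (X s)).mul_const (V s))
  have hde : deriv g =ᶠ[nhds s] fun t => V t * U s - U t * V s :=
    Filter.eventually_of_mem hnhds fun t ht => (hd t ht).deriv
  have hd2 : deriv (deriv g) s = κ s := by
    rw [hde.deriv_eq]
    refine ((((h.derivV s hs).mul_const (U s)).fun_sub
      ((h.derivU s hs).mul_const (V s))).congr_deriv ?_).deriv
    linear_combination κ s * h.unit s (Ioo_subset_Icc_self hs.1)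
  -- The supporting line makes 0 = g(s) a minimum of g, while negative curvature makes it a local
  -- maximum; so g vanishes near s, contradicting g''(s) = κ(s) < 0.
  have hmax : IsLocalMax g s := isLocalMax_of_deriv_deriv_neg (hd2 ▸ hneg)
    (by rw [(hd s hs.1).deriv]; ring) (hd s hs.1).continuousAt
  have hz : g =ᶠ[nhds s] fun _ => 0 := by
    filter_upwards [hmax, hnhds] with t ht ht'
    refine le_antisymm (ht.trans (by simp [hg])) ?_
    exact hsupp s (Ioo_subset_Icc_self hs.1) t (Ioo_subset_Icc_self ht')
  have : deriv (deriv g) s = 0 := by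
    rw [hz.deriv.deriv_eq]; simp
  linarith

theorem angle_mono (h : FramedCurve X Y U V κ C a b) (hκ : ∀ s ∈ Ioo a b \ C, 0 ≤ κ s) :
    MonotoneOn (fun s => ∫ u in a..s, κ u) (Icc a b) := by
  intro s hs t ht hst
  have h1 := intervalIntegral.integral_interval_sub_left (h.intCurv_right ht) (h.intCurv_right hs)
  have h2 : 0 ≤ ∫ u in s..t, κ u := by
    refine intervalIntegral.integral_nonneg_of_ae_restrict hst ?_
    have hC : ∀ᵐ u ∂(volume.restrict (Icc s t)), u ∉ C ∪ {a, b} :=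
      ae_restrict_of_ae (measure_eq_zero_iff_ae_notMem.1
        ((h.countable.union (Set.toFinite {a, b}).countable).measure_zero _))
    filter_upwards [hC, ae_restrict_mem measurableSet_Icc] with u hu hu'
    simp only [mem_union, mem_insert_iff, mem_singleton_iff, not_or] at hu
    exact hκ u ⟨⟨lt_of_le_of_ne (hs.1.trans hu'.1) (Ne.symm hu.2.1),
      lt_of_le_of_ne (hu'.2.trans ht.2) hu.2.2⟩, hu.1⟩
  simp only
  linarith

/-- The Minkowski formula for an arc whose end tangents are opposite. -/
theorem integral_support_mul_curvature (h : FramedCurve X Y U V κ C a b)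
    (hU : U b = -U a) (hV : V b = -V a) {m₁ m₂ : ℝ} (hm₁ : m₁ = (X a + X b) / 2)
    (hm₂ : m₂ = (Y a + Y b) / 2) :
    ∫ s in a..b, ((X s - m₁) * V s - (Y s - m₂) * U s) * κ s = b - a := by
  have hX := h.contX
  have hY := h.contY
  have hcU := h.contU
  have hcV := h.contV
  have hpc : ContinuousOn (fun s => (X s - m₁) * V s - (Y s - m₂) * U s) (uIcc a b) := by
    rw [uIcc_of_le h.lt.le]; fun_prop
  have hi := h.intCurv.continuousOn_mul hpc
  -- The derivative of ⟨γ - m, 𝐭⟩ is 1 - pκ; its two boundary values agree because both γ - m and 𝐭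
  -- change sign from a to b.
  have h1 := integral_eq_of_hasDerivAt_off_countable_of_le
    (fun s => (X s - m₁) * U s + (Y s - m₂) * V s)
    (fun s => 1 - ((X s - m₁) * V s - (Y s - m₂) * U s) * κ s) h.lt.le h.countable
    (by fun_prop) (fun s hs => ?_) (intervalIntegrable_const.sub hi)
  · rw [intervalIntegral.integral_sub intervalIntegrable_const hi,
      intervalIntegral.integral_const, smul_eq_mul, mul_one, hU, hV, hm₁, hm₂] at h1
    rw [hm₁, hm₂]
    linarith
  · refine ((((h.derivX s hs.1).sub_const m₁).fun_mul (h.derivU s hs)).fun_add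
      (((h.derivY s hs.1).sub_const m₂).fun_mul (h.derivV s hs))).congr_deriv ?_
    linear_combination h.unit s (Ioo_subset_Icc_self hs.1)

end FramedCurve

/-! ### Bonnesen's inequality -/

/-- Schmidt's comparison of a unit speed curve in the strip `|x| ≤ r` with a circle of radius `r`:
the area swept out by the curve and the circle is controlled by the length of the curve. -/
theorem schmidt_comparison {x y x' y' G g : ℝ → ℝ} {a b r : ℝ} (hab : a ≤ b)
    (hx : ContinuousOn x (Icc a b)) (hy : ContinuousOn y (Icc a b))
    (hx' : ContinuousOn x' (Icc a b)) (hy' : ContinuousOn y' (Icc a b))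
    (hdx : ∀ s ∈ Ioo a b, HasDerivAt x (x' s) s) (hdy : ∀ s ∈ Ioo a b, HasDerivAt y (y' s) s)
    (hunit : ∀ s ∈ Icc a b, x' s ^ 2 + y' s ^ 2 = 1) (hr : ∀ s ∈ Icc a b, |x s| ≤ r)
    (hg : Continuous g) (hG : ∀ u, HasDerivAt G (g u) u)
    (hgr : ∀ u, |u| ≤ r → g u ^ 2 = r ^ 2 - u ^ 2) :
    1 / 2 * (∫ s in a..b, (x s * y' s - y s * x' s)) + 1 / 2 * (x b * y b - x a * y a)
      + (G (x b) - G (x a)) ≤ r * (b - a) := by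
  have hGc : Continuous G := continuous_iff_continuousAt.2 fun u => (hG u).continuousAt
  have hp : ContinuousOn (fun s => x s * y' s - y s * x' s) (Icc a b) := by fun_prop
  have hh : ContinuousOn (fun s => 1 / 2 * (x' s * y s + x s * y' s) + g (x s) * x' s)
      (Icc a b) := by fun_prop
  have hpi := hp.intervalIntegrable_of_Icc (μ := volume) hab
  have hhi := hh.intervalIntegrable_of_Icc (μ := volume) hab
  have h1 := intervalIntegral.integral_eq_sub_of_hasDerivAt_of_le hab
    (f := fun s => 1 / 2 * (x s * y s) + G (x s)) (by fun_prop)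
    (fun s hs => ((((hdx s hs).fun_mul (hdy s hs)).const_mul (1 / 2)).fun_add
      ((hG (x s)).comp s (hdx s hs)))) hhi
  have h2 : ∫ s in a..b, (1 / 2 * (x s * y' s - y s * x' s)
      + (1 / 2 * (x' s * y s + x s * y' s) + g (x s) * x' s)) ≤ ∫ _ in a..b, r := by
    refine intervalIntegral.integral_mono_on hab ((hpi.const_mul _).add hhi)
      intervalIntegrable_const fun s hs => ?_
    have h3 : 0 ≤ r := (abs_nonneg _).trans (hr s hs)
    -- Cauchy–Schwarz for (x, g(x)), of length r, and the unit vector (y', x').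
    have h4 : (x s * y' s + g (x s) * x' s) ^ 2 ≤ r ^ 2 := by
      have e : r ^ 2 = x s ^ 2 + g (x s) ^ 2 := by rw [hgr _ (hr s hs)]; ring
      have e2 := hunit s hs
      nlinarith [sq_nonneg (x s * x' s - g (x s) * y' s)]
    have h5 := (abs_le.1 (abs_le_of_sq_le_sq h4 h3)).2
    linarith
  rw [intervalIntegral.integral_add (hpi.const_mul _) hhi, h1,
    intervalIntegral.integral_const_mul, intervalIntegral.integral_const, smul_eq_mul] at h2
  linarith

namespace FramedCurve

variable {X Y U V κ : ℝ → ℝ} {C : Set ℝ} {a b : ℝ}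

/-- Bonnesen's inequality for the centrally symmetric curve made of a convex arc of total curvature
`π` and of its reflection in the midpoint of its chord. -/
theorem bonnesen (h : FramedCurve X Y U V κ C a b) (hκ : ∀ s ∈ Ioo a b \ C, 0 ≤ κ s)
    (hturn : ∫ s in a..b, κ s = Real.pi) {m₁ m₂ : ℝ} (hm₁ : m₁ = (X a + X b) / 2)
    (hm₂ : m₂ = (Y a + Y b) / 2) {t : ℝ} (ht : t ∈ Icc a b) :
    1 / 2 * (∫ s in a..b, ((X s - m₁) * V s - (Y s - m₂) * U s))
      + Real.pi / 2 * ((X t - m₁) * V t - (Y t - m₂) * U t) ^ 2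
      ≤ ((X t - m₁) * V t - (Y t - m₂) * U t) * (b - a) := by
  have hX := h.contX
  have hY := h.contY
  have hcU := h.contU
  have hcV := h.contV
  set φ : ℝ → ℝ := fun s => ∫ u in a..s, κ u with hφ
  have hmono : MonotoneOn φ (Icc a b) := h.angle_mono hκ
  have ha : a ∈ Icc a b := left_mem_Icc.2 h.lt.le
  have hb : b ∈ Icc a b := right_mem_Icc.2 h.lt.le
  have hφ0 : ∀ s ∈ Icc a b, 0 ≤ φ s := fun s hs => by
    have := hmono ha hs hs.1
    simpa [hφ] using this
  have hφπ : ∀ s ∈ Icc a b, φ s ≤ Real.pi := fun s hs => hturn ▸ hmono hs hb hs.2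
  -- Coordinates centred at m along the outward normal and the tangent at t, so that x(t) = p(t) is
  -- the radius of the comparison circle.
  set x : ℝ → ℝ := fun s => (X s - m₁) * V t - (Y s - m₂) * U t with hx
  set y : ℝ → ℝ := fun s => (X s - m₁) * U t + (Y s - m₂) * V t with hy
  set x' : ℝ → ℝ := fun s => U s * V t - V s * U t with hx'
  set y' : ℝ → ℝ := fun s => U s * U t + V s * V t with hy'
  have hdx : ∀ s ∈ Ioo a b, HasDerivAt x (x' s) s := fun s hs =>
    (((h.derivX s hs).sub_const m₁).mul_const (V t)).fun_sub
      (((h.derivY s hs).sub_const m₂).mul_const (U t))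
  have hdy : ∀ s ∈ Ioo a b, HasDerivAt y (y' s) s := fun s hs =>
    (((h.derivX s hs).sub_const m₁).mul_const (U t)).fun_add
      (((h.derivY s hs).sub_const m₂).mul_const (V t))
  have hxc : ContinuousOn x (Icc a b) := by fun_prop
  have hyc : ContinuousOn y (Icc a b) := by fun_prop
  have hxc' : ContinuousOn x' (Icc a b) := by fun_prop
  have hyc' : ContinuousOn y' (Icc a b) := by fun_prop
  -- Since φ takes values in [0, π], x increases up to t and decreases afterwards; with x(b) = -x(a)
  -- this confines the arc to the strip |x| ≤ x(t).
  have hsin : ∀ s ∈ Icc a b, x' s = Real.sin (φ t - φ s) := by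
    intro s hs
    obtain ⟨h1, h2⟩ := h.tangent_eq hs
    obtain ⟨h3, h4⟩ := h.tangent_eq ht
    have h5 := h.unit a ha
    simp only [hx', Real.sin_sub]
    rw [h1, h2, h3, h4]
    linear_combination (Real.sin (φ t) * Real.cos (φ s) - Real.cos (φ t) * Real.sin (φ s)) * h5
  have hL : Icc a t ⊆ Icc a b := Icc_subset_Icc_right ht.2
  have hR : Icc t b ⊆ Icc a b := Icc_subset_Icc_left ht.1
  have hLo : Ioo a t ⊆ Ioo a b := Ioo_subset_Ioo_right ht.2
  have hRo : Ioo t b ⊆ Ioo a b := Ioo_subset_Ioo_left ht.1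
  have hinc : MonotoneOn x (Icc a t) := by
    refine monotoneOn_of_deriv_nonneg (convex_Icc _ _) (hxc.mono hL) ?_ ?_ <;>
      rw [interior_Icc]
    · exact fun s hs => (hdx s (hLo hs)).differentiableAt.differentiableWithinAt
    · intro s hs
      have hs' := hL (Ioo_subset_Icc_self hs)
      rw [(hdx s (hLo hs)).deriv, hsin s hs']
      refine Real.sin_nonneg_of_nonneg_of_le_pi (sub_nonneg.2 (hmono hs' ht hs.2.le)) ?_
      linarith [hφ0 s hs', hφπ t ht]
  have hdec : AntitoneOn x (Icc t b) := by
    refine antitoneOn_of_deriv_nonpos (convex_Icc _ _) (hxc.mono hR) ?_ ?_ <;>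
      rw [interior_Icc]
    · exact fun s hs => (hdx s (hRo hs)).differentiableAt.differentiableWithinAt
    · intro s hs
      have hs' := hR (Ioo_subset_Icc_self hs)
      rw [(hdx s (hRo hs)).deriv, hsin s hs']
      refine Real.sin_nonpos_of_nonpos_of_neg_pi_le (sub_nonpos.2 (hmono ht hs' hs.1.le)) ?_
      linarith [hφ0 t ht, hφπ s hs']
  have hab : x b = -x a := by simp only [hx, hm₁, hm₂]; ring
  have haby : y b = -y a := by simp only [hy, hm₁, hm₂]; ring
  have hat : x a ≤ x t := hinc (left_mem_Icc.2 ht.1) (right_mem_Icc.2 ht.1) ht.1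
  have hbt : x b ≤ x t := hdec (left_mem_Icc.2 ht.2) (right_mem_Icc.2 ht.2) ht.2
  have habsL : ∀ s ∈ Icc a t, |x s| ≤ x t := fun s hs => by
    have h1 := hinc (left_mem_Icc.2 ht.1) hs hs.1
    have h2 := hinc hs (right_mem_Icc.2 ht.1) hs.2
    exact abs_le.2 ⟨by linarith, h2⟩
  have habsR : ∀ s ∈ Icc t b, |x s| ≤ x t := fun s hs => by
    have h1 := hdec (left_mem_Icc.2 ht.2) hs hs.1
    have h2 := hdec hs (right_mem_Icc.2 ht.2) hs.2
    exact abs_le.2 ⟨by linarith, h1⟩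
  have hr : 0 ≤ x t := (abs_nonneg _).trans (habsL a (left_mem_Icc.2 ht.1))
  obtain ⟨F, hF, hFodd, hFr⟩ := exists_odd_primitive_sqrt (x t) hr
  have hut := h.unit t ht
  have hunit : ∀ s ∈ Icc a b, x' s ^ 2 + y' s ^ 2 = 1 := fun s hs => by
    simp only [hx', hy']
    linear_combination (U t ^ 2 + V t ^ 2) * h.unit s hs + hut
  have hsq : ∀ u, |u| ≤ x t → √(x t ^ 2 - u ^ 2) ^ 2 = x t ^ 2 - u ^ 2 := fun u hu =>
    Real.sq_sqrt (sub_nonneg.2 (sq_le_sq' (abs_le.1 hu).1 (abs_le.1 hu).2))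
  -- The two square root branches serve before and after t. When the inequalities are added, oddness
  -- of F cancels the endpoint values and leaves 2F(r) = πr²/2, while the xy terms cancel.
  have h1 := schmidt_comparison ht.1 (hxc.mono hL) (hyc.mono hL) (hxc'.mono hL) (hyc'.mono hL)
    (fun s hs => hdx s (hLo hs)) (fun s hs => hdy s (hLo hs)) (fun s hs => hunit s (hL hs)) habsL
    (g := fun u => √(x t ^ 2 - u ^ 2)) (by fun_prop) hF hsq
  have h2 := schmidt_comparison ht.2 (hxc.mono hR) (hyc.mono hR) (hxc'.mono hR) (hyc'.mono hR)
    (fun s hs => hdx s (hRo hs)) (fun s hs => hdy s (hRo hs)) (fun s hs => hunit s (hR hs)) habsR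
    (g := fun u => -√(x t ^ 2 - u ^ 2)) (by fun_prop) (fun u => (hF u).fun_neg)
    (fun u hu => by rw [neg_sq]; exact hsq u hu)
  have hp : ContinuousOn (fun s => x s * y' s - y s * x' s) (Icc a b) := by fun_prop
  have h3 := intervalIntegral.integral_add_adjacent_intervals
    ((hp.mono hL).intervalIntegrable_of_Icc (μ := volume) ht.1)
    ((hp.mono hR).intervalIntegrable_of_Icc (μ := volume) ht.2)
  have h4 : ∀ s, x s * y' s - y s * x' s = (X s - m₁) * V s - (Y s - m₂) * U s := fun s => by
    simp only [hx, hy, hx', hy']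
    linear_combination ((X s - m₁) * V s - (Y s - m₂) * U s) * hut
  simp only [h4] at h1 h2 h3
  rw [hab, hFodd, haby] at h2
  rw [← h3]
  change _ + Real.pi / 2 * x t ^ 2 ≤ x t * (b - a)
  rw [hFr] at h1 h2
  linarith

/-! ### The sharp inequality for framed curves -/

/-- The sharp lower bound `A E² ≥ π³ / 8` for a convex arc of total curvature `π`. -/
theorem pi_pow_three_le_of_turn (h : FramedCurve X Y U V κ C a b) {K : Set (ℝ × ℝ)}
    (hK : Convex ℝ K) (hfin : volume K ≠ ⊤) (hinj : InjOn (fun s => (X s, Y s)) (Icc a b))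
    (hXY : ∀ s ∈ Icc a b, (X s, Y s) ∈ K)
    (hsupp : ∀ s ∈ Icc a b, ∀ p ∈ K, 0 ≤ (p.2 - Y s) * U s - (p.1 - X s) * V s)
    (hturn : ∫ s in a..b, κ s = Real.pi) :
    Real.pi ^ 3 / 2 ≤ (volume K).toReal * (∫ s in a..b, κ s ^ 2) ^ 2 := by
  have hκ : ∀ s ∈ Ioo a b \ C, 0 ≤ κ s := fun s hs =>
    h.curvature_nonneg (fun s hs t ht => hsupp s hs _ (hXY t ht)) hs
  have ha : a ∈ Icc a b := left_mem_Icc.2 h.lt.le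
  have hb : b ∈ Icc a b := right_mem_Icc.2 h.lt.le
  obtain ⟨m₁, hm₁⟩ : ∃ m, m = (X a + X b) / 2 := ⟨_, rfl⟩
  obtain ⟨m₂, hm₂⟩ : ∃ m, m = (Y a + Y b) / 2 := ⟨_, rfl⟩
  have hm : (m₁, m₂) ∈ K := by
    have := hK (hXY a ha) (hXY b hb) (by norm_num : (0 : ℝ) ≤ 1 / 2)
      (by norm_num : (0 : ℝ) ≤ 1 / 2) (by norm_num)
    convert this using 1
    simp only [hm₁, hm₂, Prod.smul_mk, smul_eq_mul, Prod.mk_add_mk, Prod.mk.injEq]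
    constructor <;> ring
  have hUV := h.tangent_eq hb
  rw [hturn, Real.cos_pi, Real.sin_pi] at hUV
  have hUb : U b = -U a := by linarith [hUV.1]
  have hVb : V b = -V a := by linarith [hUV.2]
  have hX := h.contX
  have hY := h.contY
  have hcU := h.contU
  have hcV := h.contV
  have harea := half_integral_le_volume h.lt.le hX hY hcU hcV h.derivX h.derivY hinj hK hm hXY
    hsupp hfin
  have hmink := h.integral_support_mul_curvature hUb hVb hm₁ hm₂
  have hbon := fun t (ht : t ∈ Icc a b) => h.bonnesen hκ hturn hm₁ hm₂ ht
  set p : ℝ → ℝ := fun s => (X s - m₁) * V s - (Y s - m₂) * U s with hp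
  have hpc : ContinuousOn p (Icc a b) := by fun_prop
  have hpi : IntervalIntegrable p volume a b := hpc.intervalIntegrable_of_Icc h.lt.le
  have hp2 : IntervalIntegrable (fun s => p s ^ 2) volume a b :=
    (hpc.pow 2).intervalIntegrable_of_Icc h.lt.le
  have hpk : IntervalIntegrable (fun s => p s * κ s) volume a b :=
    h.intCurv.continuousOn_mul (by rwa [uIcc_of_le h.lt.le])
  have hcs := sq_integral_mul_le h.lt.le hp2 h.intCurvSq hpk
  have hcs2 := sq_integral_mul_le (f := fun _ => 1) h.lt.le (by simp) h.intCurvSq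
    (by simpa using h.intCurv)
  simp only [one_mul, one_pow, intervalIntegral.integral_const, smul_eq_mul, mul_one, hturn]
    at hcs2
  change ∫ s in a..b, p s * κ s = b - a at hmink
  rw [hmink] at hcs
  have hint : ∫ s in a..b, (1 / 2 * (∫ u in a..b, p u) + Real.pi / 2 * p s ^ 2)
      ≤ ∫ s in a..b, p s * (b - a) :=
    intervalIntegral.integral_mono_on h.lt.le (intervalIntegrable_const.add (hp2.const_mul _))
      (hpi.mul_const _) fun s hs => hbon s hs
  rw [intervalIntegral.integral_add intervalIntegrable_const (hp2.const_mul _),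
    intervalIntegral.integral_const, intervalIntegral.integral_const_mul,
    intervalIntegral.integral_mul_const, smul_eq_mul] at hint
  have hl : 0 < b - a := sub_pos.2 h.lt
  have hQ : 0 ≤ ∫ s in a..b, κ s ^ 2 :=
    intervalIntegral.integral_nonneg h.lt.le fun s _ => sq_nonneg _
  set l := b - a
  set Q := ∫ s in a..b, κ s ^ 2
  set P := ∫ s in a..b, p s
  set P2 := ∫ s in a..b, p s ^ 2
  have hπ := Real.pi_pos
  have h1 : Real.pi * l ≤ P * Q := by
    have e1 : Real.pi * P2 ≤ l * P := by linarith
    have e2 : l * (Real.pi * l) ≤ l * (P * Q) := by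
      calc l * (Real.pi * l) = Real.pi * l ^ 2 := by ring
        _ ≤ Real.pi * (P2 * Q) := mul_le_mul_of_nonneg_left hcs hπ.le
        _ = (Real.pi * P2) * Q := by ring
        _ ≤ (l * P) * Q := mul_le_mul_of_nonneg_right e1 hQ
        _ = l * (P * Q) := by ring
    exact le_of_mul_le_mul_left e2 hl
  have h2 : Real.pi ^ 3 ≤ P * Q ^ 2 := by
    calc Real.pi ^ 3 = Real.pi * Real.pi ^ 2 := by ring
      _ ≤ Real.pi * (l * Q) := mul_le_mul_of_nonneg_left hcs2 hπ.le
      _ = (Real.pi * l) * Q := by ring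
      _ ≤ (P * Q) * Q := mul_le_mul_of_nonneg_right h1 hQ
      _ = P * Q ^ 2 := by ring
  have h3 := mul_le_mul_of_nonneg_right harea (sq_nonneg Q)
  change 1 / 2 * P * Q ^ 2 ≤ _ at h3
  linarith

/-- The sharp lower bound for a convex arc which is not straight and has parallel end tangents. -/
theorem pi_pow_three_le (h : FramedCurve X Y U V κ C a b) {K : Set (ℝ × ℝ)}
    (hK : Convex ℝ K) (hfin : volume K ≠ ⊤) (hinj : InjOn (fun s => (X s, Y s)) (Icc a b))
    (hXY : ∀ s ∈ Icc a b, (X s, Y s) ∈ K)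
    (hsupp : ∀ s ∈ Icc a b, ∀ p ∈ K, 0 ≤ (p.2 - Y s) * U s - (p.1 - X s) * V s)
    (hpar : ∃ r : ℝ, U b = r * U a ∧ V b = r * V a)
    (hbend : ∃ s ∈ Icc a b, U s ≠ U a ∨ V s ≠ V a) :
    Real.pi ^ 3 / 2 ≤ (volume K).toReal * (∫ s in a..b, κ s ^ 2) ^ 2 := by
  have hκ : ∀ s ∈ Ioo a b \ C, 0 ≤ κ s := fun s hs =>
    h.curvature_nonneg (fun s hs t ht => hsupp s hs _ (hXY t ht)) hs
  have ha : a ∈ Icc a b := left_mem_Icc.2 h.lt.le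
  have hb : b ∈ Icc a b := right_mem_Icc.2 h.lt.le
  have hmono := h.angle_mono hκ
  have hcont := h.continuousOn_angle
  have htan := fun s (hs : s ∈ Icc a b) => h.tangent_eq hs
  set φ : ℝ → ℝ := fun s => ∫ u in a..s, κ u with hφ
  have hφa : φ a = 0 := intervalIntegral.integral_same
  -- Parallel end tangents force sin φ(b) = 0. If φ(b) < π then φ(b) = 0, and the monotone φ
  -- vanishes identically, so the arc is straight.
  have hge : Real.pi ≤ φ b := by
    by_contra! hlt
    have h0 : 0 ≤ φ b := hφa ▸ hmono ha hb h.lt.le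
    obtain ⟨r, hr1, hr2⟩ := hpar
    obtain ⟨e1, e2⟩ := htan b hb
    change U b = Real.cos (φ b) * U a - Real.sin (φ b) * V a at e1
    change V b = Real.sin (φ b) * U a + Real.cos (φ b) * V a at e2
    have hu := h.unit a ha
    have hsin : Real.sin (φ b) = 0 := by
      have : Real.sin (φ b) * (U a ^ 2 + V a ^ 2) = 0 := by
        linear_combination V a * (e1 - hr1) - U a * (e2 - hr2)
      rwa [hu, mul_one] at this
    have hφb : φ b = 0 := by
      by_contra hne
      exact (Real.sin_pos_of_pos_of_lt_pi (lt_of_le_of_ne h0 (Ne.symm hne)) hlt).ne' hsin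
    obtain ⟨s, hs, hne⟩ := hbend
    have hs0 : φ s = 0 :=
      le_antisymm (hφb ▸ hmono hs hb hs.2) (hφa ▸ hmono ha hs hs.1)
    obtain ⟨f1, f2⟩ := htan s hs
    change U s = Real.cos (φ s) * U a - Real.sin (φ s) * V a at f1
    change V s = Real.sin (φ s) * U a + Real.cos (φ s) * V a at f2
    rw [hs0, Real.cos_zero, Real.sin_zero] at f1 f2
    rcases hne with hne | hne
    · exact hne (by linarith)
    · exact hne (by linarith)
  obtain ⟨d, hd, hdπ⟩ := intermediate_value_Icc h.lt.le hcont ⟨hφa ▸ Real.pi_pos.le, hge⟩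
  have had : a < d := by
    refine lt_of_le_of_ne hd.1 fun hne => ?_
    rw [← hne, hφa] at hdπ
    exact Real.pi_pos.ne hdπ
  have hsub : Icc a d ⊆ Icc a b := Icc_subset_Icc_right hd.2
  have h1 := (h.mono_right had hd.2).pi_pow_three_le_of_turn hK hfin (hinj.mono hsub)
    (fun s hs => hXY s (hsub hs)) (fun s hs => hsupp s (hsub hs)) hdπ
  refine h1.trans (mul_le_mul_of_nonneg_left ?_ ENNReal.toReal_nonneg)
  refine pow_le_pow_left₀ (intervalIntegral.integral_nonneg had.le fun s _ => sq_nonneg _) ?_ 2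
  exact intervalIntegral.integral_mono_interval le_rfl had.le hd.2
    (Filter.Eventually.of_forall fun s => sq_nonneg _) h.intCurvSq

end FramedCurve

/-! ### Boundedness of convex sets with bounded frontier -/

/-- A preconnected set which meets a set `t` without meeting its frontier lies in `t`. -/
theorem IsPreconnected.subset_of_disjoint_frontier {α : Type*} [TopologicalSpace α] {s t : Set α}
    (hs : IsPreconnected s) (hst : (s ∩ t).Nonempty) (hf : ∀ x ∈ s, x ∉ frontier t) : s ⊆ t := by
  have h := hs.subset_left_of_subset_union (u := interior t) (v := (closure t)ᶜ) isOpen_interior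
    isClosed_closure.isOpen_compl
    (disjoint_left.2 fun x hx hx' => hx' (subset_closure (interior_subset hx))) (fun x hx => ?_) ?_
  · exact h.trans interior_subset
  · by_cases hx' : x ∈ interior t
    · exact Or.inl hx'
    · exact Or.inr fun hc => hf x hx ⟨hc, hx'⟩
  · obtain ⟨x, hx, hxt⟩ := hst
    refine ⟨x, hx, ?_⟩
    by_contra hx'
    exact hf x hx ⟨subset_closure hxt, hx'⟩

/-- Polar coordinates: a ray times the unit sphere, which is connected in dimension at least two. A
convex set with bounded frontier then contains all or nothing of the exterior of a large ball. -/
theorem isPreconnected_setOf_lt_norm {E : Type*} [NormedAddCommGroup E] [NormedSpace ℝ E]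
    (hE : 1 < Module.rank ℝ E) {R : ℝ} (hR : 0 ≤ R) : IsPreconnected {x : E | R < ‖x‖} := by
  have h : {x : E | R < ‖x‖} =
      (fun q : ℝ × E => q.1 • q.2) '' (Ioi R ×ˢ Metric.sphere (0 : E) 1) := by
    ext x
    simp only [mem_ofPred_eq, mem_image, mem_prod, mem_Ioi, mem_sphere_iff_norm, sub_zero,
      Prod.exists]
    constructor
    · intro hx
      have hx0 : ‖x‖ ≠ 0 := (hR.trans_lt hx).ne'
      exact ⟨‖x‖, ‖x‖⁻¹ • x, ⟨hx, by rw [norm_smul, norm_inv, norm_norm, inv_mul_cancel₀ hx0]⟩,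
        by rw [smul_smul, mul_inv_cancel₀ hx0, one_smul]⟩
    · rintro ⟨r, y, ⟨hr, hy⟩, rfl⟩
      rw [norm_smul, hy, mul_one, Real.norm_eq_abs]
      exact hr.trans_le (le_abs_self r)
  rw [h]
  exact (isPreconnected_Ioi.prod (isPreconnected_sphere hE 0 1)).image _ (by fun_prop)

/-- In dimension at least two, a proper convex set with bounded frontier is bounded. -/
theorem Convex.isBounded_of_isBounded_frontier {E : Type*} [NormedAddCommGroup E]
    [NormedSpace ℝ E] (hE : 1 < Module.rank ℝ E) {K : Set E} (hK : Convex ℝ K)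
    (hf : Bornology.IsBounded (frontier K)) (hne : K ≠ univ) : Bornology.IsBounded K := by
  obtain ⟨R, hR, hfR⟩ := hf.exists_pos_norm_le
  by_contra hb
  apply hne
  obtain ⟨x, hxK, hxR⟩ : ∃ x ∈ K, R < ‖x‖ := by
    by_contra! h
    exact hb (isBounded_iff_forall_norm_le.2 ⟨R, h⟩)
  have hsub : {x : E | R < ‖x‖} ⊆ K :=
    (isPreconnected_setOf_lt_norm hE hR.le).subset_of_disjoint_frontier ⟨x, hxR, hxK⟩
      fun y hy hy' => (hfR y hy').not_gt hy
  refine eq_univ_of_forall fun y => ?_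
  -- Any y is the midpoint of y + v and y - v, which lie outside the ball once v is long enough.
  obtain ⟨v, hv⟩ : ∃ v : E, R + ‖y‖ < ‖v‖ := by
    have hx0 : 0 < ‖x‖ := hR.trans hxR
    refine ⟨((R + ‖y‖ + 1) / ‖x‖) • x, ?_⟩
    rw [norm_smul, Real.norm_of_nonneg (by positivity), div_mul_cancel₀ _ hx0.ne']
    linarith
  have h1 : y + v ∈ K := hsub (by
    have := norm_sub_norm_le v (-y)
    rw [norm_neg, sub_neg_eq_add, add_comm v] at this
    exact lt_of_lt_of_le (by linarith) this)
  have h2 : y - v ∈ K := hsub (by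
    have := norm_sub_norm_le v y
    rw [norm_sub_rev] at this
    exact lt_of_lt_of_le (by linarith) this)
  have := hK h1 h2 (by norm_num : (0 : ℝ) ≤ 1 / 2) (by norm_num : (0 : ℝ) ≤ 1 / 2) (by norm_num)
  convert this using 1
  module

/-! ### Smooth arcs as framed curves -/

namespace PlaneArc

theorem hasDerivAt_apply {f : ℝ → Plane} {f' : Plane} {s : ℝ} (h : HasDerivAt f f' s) (i : Fin 2) :
    HasDerivAt (fun u => f u i) (f' i) s :=
  (EuclideanSpace.proj (𝕜 := ℝ) i).hasFDerivAt.comp_hasDerivAt s h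

theorem norm_eq_one_iff (v : Plane) : ‖v‖ = 1 ↔ v 0 ^ 2 + v 1 ^ 2 = 1 := by
  rw [EuclideanSpace.norm_eq, Real.sqrt_eq_one, Fin.sum_univ_two]
  simp

variable {γ : ℝ → Plane} {a b : ℝ}

theorem IsSmoothArc.hasDerivAt (h : IsSmoothArc γ a b) {s : ℝ} (hs : s ∈ Ioo a b) :
    HasDerivAt γ (tangent γ a b s) s :=
  ((h.contDiffOn.differentiableOn one_ne_zero s
    (Ioo_subset_Icc_self hs)).hasDerivWithinAt).hasDerivAt (Icc_mem_nhds hs.1 hs.2)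

theorem IsSmoothArc.continuousOn_tangent (h : IsSmoothArc γ a b) :
    ContinuousOn (tangent γ a b) (Icc a b) :=
  h.contDiffOn.continuousOn_derivWithin (uniqueDiffOn_Icc h.lt) le_rfl

theorem inner_plane (u v : Plane) : inner ℝ u v = u 0 * v 0 + u 1 * v 1 := by
  simp [PiLp.inner_apply, Fin.sum_univ_two, mul_comm]

/-- On an interval where the arc is `C²`, the Frenet equations hold and the curvature extends
continuously to the closed interval. -/
theorem IsSmoothArc.frenet_on_piece (h : IsSmoothArc γ a b) {c d : ℝ} (hcd : c < d) (hac : a ≤ c)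
    (hdb : d ≤ b) (h2 : ContDiffOn ℝ 2 γ (Icc c d)) :
    ∃ k : ℝ → ℝ, ContinuousOn k (Icc c d) ∧ EqOn k (curvature γ a b) (Ioo c d) ∧
      ∀ s ∈ Ioo c d, HasDerivAt (fun u => tangent γ a b u 0)
          (-(curvature γ a b s * tangent γ a b s 1)) s ∧
        HasDerivAt (fun u => tangent γ a b u 1) (curvature γ a b s * tangent γ a b s 0) s := by
  have hu := uniqueDiffOn_Icc hcd
  have hT1 : ContDiffOn ℝ 1 (derivWithin γ (Icc c d)) (Icc c d) :=
    h2.derivWithin hu (by norm_num)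
  set T := derivWithin γ (Icc c d) with hT
  set T2 := derivWithin T (Icc c d) with hT2
  have hTc : ContinuousOn T (Icc c d) := hT1.continuousOn
  have hT2c : ContinuousOn T2 (Icc c d) := hT1.continuousOn_derivWithin hu le_rfl
  have hin : ∀ s ∈ Ioo c d, s ∈ Ioo a b := fun s hs => ⟨hac.trans_lt hs.1, hs.2.trans_le hdb⟩
  have heq : ∀ s ∈ Ioo c d, tangent γ a b s = T s := fun s hs => by
    rw [hT, tangent, derivWithin_of_mem_nhds (Icc_mem_nhds hs.1 hs.2),
      derivWithin_of_mem_nhds (Icc_mem_nhds (hin s hs).1 (hin s hs).2)]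
  have hd : ∀ s ∈ Ioo c d, HasDerivAt (tangent γ a b) (T2 s) s := fun s hs => by
    have h1 : HasDerivAt T (T2 s) s :=
      ((hT1.differentiableOn one_ne_zero s (Ioo_subset_Icc_self hs)).hasDerivWithinAt).hasDerivAt
        (Icc_mem_nhds hs.1 hs.2)
    refine h1.congr_of_eventuallyEq ?_
    filter_upwards [isOpen_Ioo.mem_nhds hs] with u hu using heq u hu
  have hk : ∀ s ∈ Ioo c d, curvature γ a b s = T2 s 0 * -(T s 1) + T2 s 1 * T s 0 := fun s hs => by
    rw [curvature, derivWithin_of_mem_nhds (Icc_mem_nhds (hin s hs).1 (hin s hs).2),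
      (hd s hs).deriv, inner_plane, normal, heq s hs]
    simp
  have hunit : ∀ s ∈ Ioo c d, T s 0 ^ 2 + T s 1 ^ 2 = 1 := fun s hs => by
    rw [← norm_eq_one_iff, ← heq s hs]
    exact h.unit_speed s (Ioo_subset_Icc_self (hin s hs))
  refine ⟨fun s => T2 s 0 * -(T s 1) + T2 s 1 * T s 0, by fun_prop, fun s hs => (hk s hs).symm,
    fun s hs => ?_⟩
  have hd0 := hasDerivAt_apply (hd s hs) 0
  have hd1 := hasDerivAt_apply (hd s hs) 1
  -- Differentiate |𝐭|² = 1.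
  have horth : T2 s 0 * T s 0 + T2 s 1 * T s 1 = 0 := by
    have h1 := (hd0.fun_pow 2).fun_add (hd1.fun_pow 2)
    have h2 : HasDerivAt (fun u => tangent γ a b u 0 ^ 2 + tangent γ a b u 1 ^ 2) 0 s := by
      refine (hasDerivAt_const s (1 : ℝ)).congr_of_eventuallyEq ?_
      filter_upwards [isOpen_Ioo.mem_nhds hs] with u hu
      rw [heq u hu, hunit u hu]
    have h3 := h1.unique h2
    simp only [heq s hs] at h3
    norm_num at h3
    linarith
  have hu := hunit s hs
  refine ⟨hd0.congr_deriv ?_, hd1.congr_deriv ?_⟩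
  · rw [hk s hs, heq s hs]
    linear_combination (-(T2 s 0)) * hu + T s 0 * horth
  · rw [hk s hs, heq s hs]
    linear_combination (-(T2 s 1)) * hu + T s 1 * horth

/-- An arc is a framed curve; the orientation of the plane can be reversed by `σ = -1`. -/
theorem IsSmoothArc.framedCurve (h : IsSmoothArc γ a b) {σ : ℝ} (hσ : σ ^ 2 = 1) :
    ∃ C, FramedCurve (fun s => γ s 0) (fun s => σ * γ s 1) (fun s => tangent γ a b s 0)
      (fun s => σ * tangent γ a b s 1) (fun s => σ * curvature γ a b s) C a b := by
  obtain ⟨n, p, hp0, hpn, hp⟩ := h.piecewise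
  have hmono : ∀ j ≤ n, ∀ i ≤ j, p i ≤ p j := by
    intro j
    induction j with
    | zero => intro _ i hi; rw [Nat.le_zero.1 hi]
    | succ j ih =>
      intro hj i hi
      rcases Nat.lt_or_ge j i with h1 | h1
      · rw [le_antisymm hi h1]
      · exact (ih (by omega) i h1).trans (hp j (by omega)).1.le
  have hfr := fun i (hi : i < n) => h.frenet_on_piece (hp i hi).1
    (hp0 ▸ hmono i hi.le 0 (Nat.zero_le i)) (hpn ▸ hmono n le_rfl (i + 1) hi) (hp i hi).2
  -- The exceptional set is the range of the whole sequence, including irrelevant terms beyond n;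
  -- only countability matters.
  have hpiece : ∀ s ∈ Ioo a b \ range p, ∃ i < n, s ∈ Ioo (p i) (p (i + 1)) := by
    rintro s ⟨hs, hsr⟩
    have hex : ∃ j, s < p j := ⟨n, hpn ▸ hs.2⟩
    classical
    have hspec := Nat.find_spec hex
    have hle : Nat.find hex ≤ n := Nat.find_min' hex (hpn ▸ hs.2)
    obtain ⟨i, hi⟩ : ∃ i, Nat.find hex = i + 1 := by
      refine Nat.exists_eq_succ_of_ne_zero fun h0 => ?_
      rw [h0, hp0] at hspec
      exact hspec.not_gt hs.1
    refine ⟨i, by omega, ?_, hi ▸ hspec⟩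
    have := Nat.find_min hex (m := i) (by omega)
    exact lt_of_le_of_ne (not_lt.1 this) fun he => hsr ⟨i, he⟩
  have hint : IntervalIntegrable (curvature γ a b) volume a b := by
    rw [← hp0, ← hpn]
    refine IntervalIntegrable.trans_iterate fun i hi => ?_
    obtain ⟨k, hkc, hk, -⟩ := hfr i hi
    rw [hp0, hpn]
    refine (hkc.intervalIntegrable_of_Icc (hp i hi).1.le).congr_uIoo ?_
    rwa [uIoo_of_le (hp i hi).1.le]
  have hintsq : IntervalIntegrable (fun s => curvature γ a b s ^ 2) volume a b := by
    rw [← hp0, ← hpn]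
    refine IntervalIntegrable.trans_iterate fun i hi => ?_
    obtain ⟨k, hkc, hk, -⟩ := hfr i hi
    rw [hp0, hpn]
    refine ((hkc.pow 2).intervalIntegrable_of_Icc (hp i hi).1.le).congr_uIoo ?_
    rw [uIoo_of_le (hp i hi).1.le]
    intro s hs
    simp only [Pi.pow_apply, hk hs]
  have hγ : ContinuousOn γ (Icc a b) := h.contDiffOn.continuousOn
  have ht := h.continuousOn_tangent
  refine ⟨range p, h.lt, countable_range p, by fun_prop, by fun_prop, by fun_prop, by fun_prop,
    fun s hs => hasDerivAt_apply (h.hasDerivAt hs) 0,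
    fun s hs => (hasDerivAt_apply (h.hasDerivAt hs) 1).const_mul σ, fun s hs => ?_, fun s hs => ?_,
    fun s hs => ?_, fun s hs => ?_, hint.const_mul σ, ?_⟩
  · obtain ⟨i, hi, hsi⟩ := hpiece s hs
    obtain ⟨k, -, -, hd⟩ := hfr i hi
    refine (hd s hsi).1.congr_deriv ?_
    linear_combination curvature γ a b s * tangent γ a b s 1 * hσ
  · obtain ⟨i, hi, hsi⟩ := hpiece s hs
    obtain ⟨k, -, -, hd⟩ := hfr i hi
    refine ((hd s hsi).2.const_mul σ).congr_deriv ?_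
    ring
  · obtain ⟨i, hi, hsi⟩ := hpiece s hs
    obtain ⟨k, hkc, hk, -⟩ := hfr i hi
    refine continuousAt_const.mul ((hkc.continuousAt (Icc_mem_nhds hsi.1 hsi.2)).congr ?_)
    exact Filter.eventually_of_mem (isOpen_Ioo.mem_nhds hsi) hk
  · have := (norm_eq_one_iff _).1 (h.unit_speed s hs)
    linear_combination this + tangent γ a b s 1 ^ 2 * hσ
  · simpa only [mul_pow] using hintsq.const_mul (σ ^ 2)

end PlaneArc

/-! ### Tangent lines as supporting lines -/

namespace PlaneArc

variable {γ : ℝ → Plane} {a b : ℝ} {K : Set Plane}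

theorem HoldsConvexSet.mem_frontier (hK : HoldsConvexSet γ a b K) {s : ℝ} (hs : s ∈ Icc a b) :
    γ s ∈ frontier K :=
  hK.frontier_eq ▸ Or.inr (mem_image_of_mem γ hs)

theorem HoldsConvexSet.nonempty (h : IsSmoothArc γ a b) (hK : HoldsConvexSet γ a b K) :
    K.Nonempty := by
  have : (closure K).Nonempty :=
    ⟨γ a, frontier_subset_closure (hK.mem_frontier (left_mem_Icc.2 h.lt.le))⟩
  exact closure_nonempty_iff.1 this

theorem HoldsConvexSet.isBounded (h : IsSmoothArc γ a b) (hK : HoldsConvexSet γ a b K) :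
    Bornology.IsBounded K := by
  refine hK.convex.isBounded_of_isBounded_frontier ?_ ?_ ?_
  · rw [← Module.finrank_eq_rank, finrank_euclideanSpace_fin]
    norm_num
  · rw [hK.frontier_eq]
    refine (IsCompact.isBounded ?_).union (isCompact_Icc.image_of_continuousOn
      h.contDiffOn.continuousOn).isBounded
    rw [segment_eq_image]
    exact isCompact_Icc.image (by fun_prop)
  · rintro rfl
    have := hK.mem_frontier (left_mem_Icc.2 h.lt.le)
    simp at this

/-- The signed distance from a point `y` to the tangent line of `γ` at `s`. -/
noncomputable def heightOverTangent (γ : ℝ → Plane) (a b s : ℝ) (y : Plane) : ℝ :=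
  (y 1 - γ s 1) * tangent γ a b s 0 - (y 0 - γ s 0) * tangent γ a b s 1

/-- A separating functional at γ(s) is maximal there along the arc, so it kills the tangent vector:
the supporting line is the tangent line. Openness of K makes the sign strict; the side may still
depend on s. -/
theorem HoldsConvexSet.height_sign (h : IsSmoothArc γ a b) (hK : HoldsConvexSet γ a b K) {s : ℝ}
    (hs : s ∈ Ioo a b) :
    (∀ y ∈ K, 0 < heightOverTangent γ a b s y) ∨ ∀ y ∈ K, heightOverTangent γ a b s y < 0 := by
  have hfr := hK.mem_frontier (Ioo_subset_Icc_self hs)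
  have hnot : γ s ∉ K := fun hmem => by
    rw [hK.isOpen.frontier_eq] at hfr
    exact hfr.2 hmem
  obtain ⟨f, hf⟩ := geometric_hahn_banach_open_point hK.convex hK.isOpen hnot
  have hcl : ∀ y ∈ closure K, f y ≤ f (γ s) := fun y hy =>
    closure_minimal (fun z hz => (hf z hz).le) (isClosed_le f.continuous continuous_const) hy
  have hcoord : ∀ y : Plane, f y = y 0 * f (EuclideanSpace.single 0 1)
      + y 1 * f (EuclideanSpace.single 1 1) := fun y => by
    have : y = y 0 • EuclideanSpace.single 0 1 + y 1 • EuclideanSpace.single 1 1 := by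
      ext i; fin_cases i <;> simp
    conv_lhs => rw [this]
    rw [map_add, map_smul, map_smul, smul_eq_mul, smul_eq_mul]
  have hmax : IsLocalMax (fun u => f (γ u)) s := by
    filter_upwards [Icc_mem_nhds hs.1 hs.2] with u hu
    exact hcl _ (frontier_subset_closure (hK.mem_frontier hu))
  have hd : HasDerivAt (fun u => f (γ u)) (f (tangent γ a b s)) s :=
    f.hasFDerivAt.comp_hasDerivAt s (h.hasDerivAt hs)
  have hz := hmax.hasDerivAt_eq_zero hd
  rw [hcoord] at hz
  have hu := (norm_eq_one_iff _).1 (h.unit_speed s (Ioo_subset_Icc_self hs))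
  set p := f (EuclideanSpace.single 0 1)
  set q := f (EuclideanSpace.single 1 1)
  set u := tangent γ a b s 0 with hu0
  set v := tangent γ a b s 1 with hv0
  have key : ∀ y, f y - f (γ s) = (q * u - p * v) * heightOverTangent γ a b s y := fun y => by
    rw [hcoord y, hcoord (γ s), heightOverTangent, ← hu0, ← hv0]
    linear_combination (-(p * (y 0 - γ s 0) + q * (y 1 - γ s 1))) * hu
      + ((y 0 - γ s 0) * u + (y 1 - γ s 1) * v) * hz
  have hneg : ∀ y ∈ K, (q * u - p * v) * heightOverTangent γ a b s y < 0 := fun y hy => by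
    rw [← key]; linarith [hf y hy]
  rcases lt_trichotomy (q * u - p * v) 0 with hc | hc | hc
  · exact Or.inl fun y hy => pos_of_mul_neg_right (hneg y hy) hc.le
  · obtain ⟨y, hy⟩ := hK.nonempty h
    have := hneg y hy
    rw [hc, zero_mul] at this
    exact absurd this (lt_irrefl _)
  · exact Or.inr fun y hy => neg_of_mul_neg_right (hneg y hy) hc.le

theorem IsSmoothArc.continuousOn_height (h : IsSmoothArc γ a b) (y : Plane) :
    ContinuousOn (fun s => heightOverTangent γ a b s y) (Icc a b) := by
  have h1 : ContinuousOn γ (Icc a b) := h.contDiffOn.continuousOn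
  have h2 := h.continuousOn_tangent
  unfold heightOverTangent
  fun_prop

/-- A convex set held by an arc lies on the same side of all tangent lines of the arc. -/
theorem HoldsConvexSet.exists_orientation (h : IsSmoothArc γ a b) (hK : HoldsConvexSet γ a b K) :
    ∃ σ : ℝ, (σ = 1 ∨ σ = -1) ∧ ∀ s ∈ Ioo a b, ∀ y ∈ K, 0 < σ * heightOverTangent γ a b s y := by
  obtain ⟨x, hx⟩ := hK.nonempty h
  have hc := (h.continuousOn_height x).mono Ioo_subset_Icc_self
  by_cases hpos : ∀ s ∈ Ioo a b, 0 < heightOverTangent γ a b s x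
  · refine ⟨1, Or.inl rfl, fun s hs y hy => ?_⟩
    rw [one_mul]
    exact (hK.height_sign h hs).resolve_right (fun hn => (hn x hx).not_gt (hpos s hs)) y hy
  · push Not at hpos
    obtain ⟨t, ht, hxt⟩ := hpos
    refine ⟨-1, Or.inr rfl, fun s hs y hy => ?_⟩
    have hsx : heightOverTangent γ a b s x < 0 := by
      -- A change of side would make the height of x vanish at some interior parameter.
      by_contra! hge
      obtain ⟨u, hu, hu0⟩ := isPreconnected_Ioo.intermediate_value ht hs hc ⟨hxt, hge⟩
      rcases hK.height_sign h hu with h1 | h1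
      · exact (h1 x hx).ne' hu0
      · exact (h1 x hx).ne hu0
    have := (hK.height_sign h hs).resolve_left (fun hn => (hn x hx).not_gt hsx) y hy
    linarith

/-- Two passages to the limit: in s up to the endpoints of the arc, then in y up to the closure of
K. -/
theorem IsSmoothArc.height_nonneg_closure (h : IsSmoothArc γ a b) {σ : ℝ}
    (hσ : ∀ s ∈ Ioo a b, ∀ y ∈ K, 0 < σ * heightOverTangent γ a b s y) {s : ℝ} (hs : s ∈ Icc a b)
    {y : Plane} (hy : y ∈ closure K) : 0 ≤ σ * heightOverTangent γ a b s y := by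
  have h1 : ∀ y ∈ K, 0 ≤ σ * heightOverTangent γ a b s y := fun y hy => by
    have hs' : s ∈ closure (Ioo a b) := by rwa [closure_Ioo h.lt.ne]
    refine ContinuousWithinAt.closure_le hs' continuousWithinAt_const ?_
      fun u hu => (hσ u hu y hy).le
    exact continuousWithinAt_const.mul
      ((h.continuousOn_height y s hs).mono Ioo_subset_Icc_self)
  refine closure_minimal (t := {y | 0 ≤ σ * heightOverTangent γ a b s y}) h1
    (isClosed_le continuous_const ?_) hy
  unfold heightOverTangent
  fun_prop

/-- An arc holding a convex set is not a straight segment. -/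
theorem HoldsConvexSet.exists_tangent_ne (h : IsSmoothArc γ a b) (hK : HoldsConvexSet γ a b K)
    {σ : ℝ} (hσ1 : σ ^ 2 = 1)
    (hσ : ∀ s ∈ Ioo a b, ∀ y ∈ K, 0 < σ * heightOverTangent γ a b s y) :
    ∃ s ∈ Icc a b, tangent γ a b s 0 ≠ tangent γ a b a 0 ∨
      tangent γ a b s 1 ≠ tangent γ a b a 1 := by
  by_contra! hcon
  have ha : a ∈ Icc a b := left_mem_Icc.2 h.lt.le
  have hb : b ∈ Icc a b := right_mem_Icc.2 h.lt.le
  obtain ⟨x, hx⟩ := hK.nonempty h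
  set u := tangent γ a b a 0 with hu
  set v := tangent γ a b a 1 with hv
  have huv : u ^ 2 + v ^ 2 = 1 := (norm_eq_one_iff _).1 (h.unit_speed a ha)
  have hγ : ContinuousOn γ (Icc a b) := h.contDiffOn.continuousOn
  set g : Plane → ℝ := fun y => y 1 * u - y 0 * v with hg
  have hheight : ∀ s ∈ Icc a b, ∀ y, heightOverTangent γ a b s y = g y - g (γ s) :=
    fun s hs y => by
      simp only [heightOverTangent, hg, (hcon s hs).1, (hcon s hs).2]
      ring
  have hline : ∀ s ∈ Icc a b, g (γ s) = g (γ a) := fun s hs => by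
    have hsub : Icc a s ⊆ Icc a b := Icc_subset_Icc_right hs.2
    have := intervalIntegral.integral_eq_sub_of_hasDerivAt_of_le hs.1 (f := fun r => g (γ r))
      (f' := fun _ => 0) (by simp only [hg]; have := hγ.mono hsub; fun_prop) (fun r hr => ?_)
      intervalIntegrable_const
    · rw [intervalIntegral.integral_zero] at this
      linarith
    · have hr' : r ∈ Ioo a b := ⟨hr.1, hr.2.trans_le hs.2⟩
      have hd := h.hasDerivAt hr'
      refine (((hasDerivAt_apply hd 1).mul_const u).fun_sub
        ((hasDerivAt_apply hd 0).mul_const v)).congr_deriv ?_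
      rw [(hcon r (Ioo_subset_Icc_self hr')).1, (hcon r (Ioo_subset_Icc_self hr')).2]
      ring
  have hfront : ∀ y ∈ frontier K, g y = g (γ a) := by
    intro y hy
    rw [hK.frontier_eq] at hy
    rcases hy with ⟨α, β, -, -, hαβ, rfl⟩ | ⟨s, hs, rfl⟩
    · have := hline b hb
      have e : g (α • γ a + β • γ b) = α * g (γ a) + β * g (γ b) := by
        simp [hg]; ring
      rw [e, this, ← add_mul, hαβ, one_mul]
    · exact hline s hs
  have hx0 : 0 < σ * (g x - g (γ a)) := by
    have hc : (a + b) / 2 ∈ Ioo a b := ⟨by linarith [h.lt], by linarith [h.lt]⟩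
    have := hσ _ hc x hx
    rwa [hheight _ (Ioo_subset_Icc_self hc), hline _ (Ioo_subset_Icc_self hc)] at this
  set w : Plane := !₂[-(σ * v), σ * u] with hw
  have hray : ∀ r : ℝ, g (x + r • w) = g x + r * σ := fun r => by
    simp [hg, hw]
    linear_combination r * σ * huv
  -- The frontier lies on one line, so the ray from x pointing away from that line never leaves K,
  -- contradicting boundedness.
  have hsub : (fun r : ℝ => x + r • w) '' Ici 0 ⊆ K := by
    refine (isPreconnected_Ici.image _ (by fun_prop)).subset_of_disjoint_frontier
      ⟨x, ⟨0, self_mem_Ici, by simp⟩, hx⟩ ?_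
    rintro _ ⟨r, hr, rfl⟩ hmem
    have h1 := hfront _ hmem
    rw [hray] at h1
    have h2 : σ * (g x - g (γ a)) = -(r * σ ^ 2) := by
      linear_combination σ * h1
    rw [hσ1, mul_one] at h2
    have : (0 : ℝ) ≤ r := hr
    linarith
  obtain ⟨R, hR⟩ := isBounded_iff_forall_norm_le.1 (hK.isBounded h)
  have hwn : ‖w‖ = 1 := by
    rw [norm_eq_one_iff]
    simp [hw]
    linear_combination (u ^ 2 + v ^ 2) * hσ1 + huv
  have h0 : 0 ≤ R := (norm_nonneg _).trans (hR x hx)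
  have hr : (0 : ℝ) ≤ R + ‖x‖ + 1 := by positivity
  have h1 := hR _ (hsub ⟨R + ‖x‖ + 1, hr, rfl⟩)
  have h2 := norm_sub_le (x + (R + ‖x‖ + 1) • w) x
  rw [add_sub_cancel_left, norm_smul, hwn, mul_one, Real.norm_of_nonneg hr] at h2
  linarith

/-! ### The inequality for one arc and for two -/

/-- Coordinates on the plane, with the orientation reversed if `σ = -1`. -/
theorem measurePreserving_orientedCoord {σ : ℝ} (hσ : σ = 1 ∨ σ = -1) :
    MeasurePreserving (fun q : ℝ × ℝ => (!₂[q.1, σ * q.2] : Plane)) volume volume := by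
  have h1 : MeasurePreserving (fun y : ℝ => σ * y) volume volume := by
    rcases hσ with rfl | rfl
    · simp only [one_mul]
      exact MeasurePreserving.id volume
    · simpa using Measure.measurePreserving_neg (volume : Measure ℝ)
  have h2 := (MeasurePreserving.id (volume : Measure ℝ)).prod h1
  have h3 := (volume_preserving_finTwoArrow ℝ).symm
  exact (PiLp.volume_preserving_toLp (Fin 2)).comp (h3.comp h2)

/-- The sharp inequality `A E² ≥ π³ / 8` for one arc holding a convex set. -/
theorem HoldsConvexSet.area_mul_sq_energy_ge (h : IsSmoothArc γ a b)
    (hK : HoldsConvexSet γ a b K) :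
    Real.pi ^ 3 / 8 ≤ (volume K).toReal * elasticEnergy γ a b ^ 2 := by
  obtain ⟨σ, hσ1, hσ⟩ := hK.exists_orientation h
  have hσ2 : σ ^ 2 = 1 := by rcases hσ1 with rfl | rfl <;> norm_num
  obtain ⟨C, hF⟩ := h.framedCurve hσ2
  set e : ℝ × ℝ → Plane := fun q => !₂[q.1, σ * q.2] with he
  have heγ : ∀ s, e (γ s 0, σ * γ s 1) = γ s := fun s => by
    ext i
    fin_cases i
    · simp [he]
    · simp only [he]
      simp
      linear_combination γ s 1 * hσ2
  -- The closure is needed because the arc lies in the frontier; it has the same area since the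
  -- frontier of a convex set is null.
  have hvol : volume (e ⁻¹' closure K) = volume K := by
    rw [(measurePreserving_orientedCoord hσ1).measure_preimage
      isClosed_closure.measurableSet.nullMeasurableSet]
    exact measure_congr (hK.convex.addHaar_frontier volume |> closure_ae_eq_of_null_frontier)
  have hconv : Convex ℝ (e ⁻¹' closure K) := by
    intro p hp q hq α β hα hβ hαβ
    have := hK.convex.closure hp hq hα hβ hαβ
    have e1 : e (α • p + β • q) = α • e p + β • e q := by
      ext i
      fin_cases i <;> simp [he]
      ring
    rwa [mem_preimage, e1]
  have hmem : ∀ s ∈ Icc a b, (γ s 0, σ * γ s 1) ∈ e ⁻¹' closure K := fun s hs => by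
    rw [mem_preimage, heγ]
    exact frontier_subset_closure (hK.mem_frontier hs)
  have key := hF.pi_pow_three_le hconv (by rw [hvol]; exact (hK.isBounded h).measure_lt_top.ne)
    (fun s hs t ht hst => h.simple hs ht (by rw [← heγ s, ← heγ t]; exact congrArg e hst)) hmem
    (fun s hs p hp => ?_) ?_ ?_
  · rw [hvol] at key
    simp only [mul_pow, hσ2, one_mul] at key
    rw [elasticEnergy, mul_pow]
    linarith
  · have := h.height_nonneg_closure hσ hs hp
    rw [heightOverTangent] at this
    simp [he] at this
    refine this.trans_eq ?_
    linear_combination p.2 * tangent γ a b s 0 * hσ2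
  · obtain ⟨r, hr⟩ := hK.parallel
    refine ⟨r, by rw [hr]; simp, ?_⟩
    rw [hr]
    simp
    ring
  · obtain ⟨s, hs, hne⟩ := hK.exists_tangent_ne h hσ2 hσ
    refine ⟨s, hs, hne.imp_right fun hne heq => hne ?_⟩
    have : σ ≠ 0 := by rintro rfl; norm_num at hσ2
    exact mul_left_cancel₀ this heq

theorem elasticEnergy_nonneg (hab : a ≤ b) : 0 ≤ elasticEnergy γ a b :=
  mul_nonneg (by norm_num) (intervalIntegral.integral_nonneg hab fun _ _ => sq_nonneg _)

end PlaneArc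

/-- Combination of two inequalities `A E² ≥ c` by the inequality of means. -/
theorem eight_mul_le_add_mul_sq {A A' E E' c : ℝ} (hc : 0 < c)
    (hE : 0 ≤ E) (hE' : 0 ≤ E') (h : c ≤ A * E ^ 2) (h' : c ≤ A' * E' ^ 2) :
    8 * c ≤ (A + A') * (E + E') ^ 2 := by
  have hpos : 0 < E := hE.lt_of_ne (by rintro rfl; norm_num at h; linarith)
  have hpos' : 0 < E' := hE'.lt_of_ne (by rintro rfl; norm_num at h'; linarith)
  -- With denominators cleared: A + A' ≥ c(1/E² + 1/E'²); then `h2` is (1/E² + 1/E'²)(E + E')² ≥ 8.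
  have h1 : c * (E ^ 2 + E' ^ 2) ≤ (A + A') * (E ^ 2 * E' ^ 2) := by
    nlinarith [mul_le_mul_of_nonneg_right h (sq_nonneg E'),
      mul_le_mul_of_nonneg_right h' (sq_nonneg E)]
  have h2 : 8 * (E ^ 2 * E' ^ 2) ≤ (E ^ 2 + E' ^ 2) * (E + E') ^ 2 := by
    have e1 : 2 * (E * E') ≤ E ^ 2 + E' ^ 2 := by nlinarith [sq_nonneg (E - E')]
    have e2 : 4 * (E * E') ≤ (E + E') ^ 2 := by nlinarith [sq_nonneg (E - E')]
    calc 8 * (E ^ 2 * E' ^ 2) = 2 * (E * E') * (4 * (E * E')) := by ring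
      _ ≤ _ := mul_le_mul e1 e2 (by positivity) (by positivity)
  have h3 : 8 * c * (E ^ 2 * E' ^ 2) ≤ (A + A') * (E + E') ^ 2 * (E ^ 2 * E' ^ 2) := by
    calc 8 * c * (E ^ 2 * E' ^ 2) = c * (8 * (E ^ 2 * E' ^ 2)) := by ring
      _ ≤ c * ((E ^ 2 + E' ^ 2) * (E + E') ^ 2) := mul_le_mul_of_nonneg_left h2 hc.le
      _ = c * (E ^ 2 + E' ^ 2) * (E + E') ^ 2 := by ring
      _ ≤ (A + A') * (E ^ 2 * E' ^ 2) * (E + E') ^ 2 :=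
        mul_le_mul_of_nonneg_right h1 (sq_nonneg _)
      _ = _ := by ring
  exact le_of_mul_le_mul_right h3 (by positivity)

theorem corollary3
    (γ γ' : ℝ → Plane) (a b a' b' : ℝ) (Ω Ω' : Set Plane)
    (hγ : PlaneArc.IsSmoothArc γ a b) (hγ' : PlaneArc.IsSmoothArc γ' a' b')
    (hΩ : PlaneArc.HoldsConvexSet γ a b Ω) (hΩ' : PlaneArc.HoldsConvexSet γ' a' b' Ω')
    (hdisj : Disjoint Ω Ω') :
    (volume (Ω ∪ Ω')).toReal *
        (PlaneArc.elasticEnergy γ a b + PlaneArc.elasticEnergy γ' a' b') ^ 2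
      ≥ Real.pi ^ 3 := by
  rw [measure_union hdisj hΩ'.isOpen.measurableSet,
    ENNReal.toReal_add (hΩ.isBounded hγ).measure_lt_top.ne (hΩ'.isBounded hγ').measure_lt_top.ne]
  have := eight_mul_le_add_mul_sq (by positivity)
    (PlaneArc.elasticEnergy_nonneg hγ.lt.le) (PlaneArc.elasticEnergy_nonneg hγ'.lt.le)
    (hΩ.area_mul_sq_energy_ge hγ) (hΩ'.area_mul_sq_energy_ge hγ')
  linarith
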